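/- Rings are associative and need not have a unit, and ideals are two-sided. Let $R$ be a ring and let $(P,Q,\psi)$ be an $R$-system, i.e. $P,Q$ are $R$-bimodules and $\psi:P\otimes_R Q\to R$ is an $R$-bimodule homomorphism. For $q\in Q$, $p\in P$ put $\theta_{q,p}(z)=q\,\psi(p\otimes z)$ ($z\in Q$) and $\theta_{p,q}(y)=\psi(y\otimes q)\,p$ ($y\in P$); let $\mathcal F_P(Q)$ and $\mathcal F_Q(P)$ be the additive spans of the maps $\theta_{q,p}$ and of the maps $\theta_{p,q}$, respectively, and let $\Delta(r)(q)=rq$ for $r\in R$, $q\in Q$. Assume condition (FS): for all finite sets $\{q_i\}\subseteq Q$ and $\{p_j\}\subseteq P$ there are $\Theta\in\mathcal F_P(Q)$ and $\Omega\in\mathcal F_Q(P)$ with $\Theta(q_i)=q_i$ and $\Omega(p_j)=p_j$ for all $i,j$. An ideal $J$ of $R$ is called $\psi$-compatible if $\Delta(J)\subseteq\mathcal F_P(Q)$, and faithful if $J\cap\ker\Delta=\{0\}$; a faithful $\psi$-compatible ideal is called uniquely maximal if it contains every faithful $\psi$-compatible ideal of $R$. A covariant representation $(S,T,\sigma,B)$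 of $(P,Q,\psi)$ consists of a ring $B$, additive maps $S:P\to B$, $T:Q\to B$ and a ring homomorphism $\sigma:R\to B$ such that $S(pr)=S(p)\sigma(r)$, $S(rp)=\sigma(r)S(p)$, $T(qr)=T(q)\sigma(r)$, $T(rq)=\sigma(r)T(q)$ and $\sigma(\psi(p\otimes q))=S(p)T(q)$ for all $r\in R$, $p\in P$, $q\in Q$. Let $(\iota_P,\iota_Q,\iota_R,\mathcal T_{(P,Q,\psi)})$ be the universal one (the Toeplitz representation). Let $\pi:\mathcal F_P(Q)\to\mathcal T_{(P,Q,\psi)}$ be the homomorphism with $\pi(\theta_{q,p})=\iota_Q(q)\iota_P(p)$, which is well defined by (FS). If a uniquely maximal faithful $\psi$-compatible ideal $J$ of $R$ exists, let $\mathcal O_{(P,Q,\psi)}$ be the Cuntz--Pimsner ring, i.e. the quotient of $\mathcal T_{(P,Q,\psi)}$ by the ideal generated by $\{\iota_R(r)-\pi(\Delta(r)) : r\in J\}$. Give it the $\mathbb Z$-grading whose degree $k$ component is the sum over $m,n\ge 0$ with $m-n=k$ of the additive spans of the images of the products $\iota_Q(q_1)\cdots\iota_Q(q_m)\iota_P(p_1)\cdots\iota_P(p_n)$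 (of $\iota_R(R)$ if $m=n=0$), and let $p_r$ be the image of $\iota_R(r)$ in $\mathcal O_{(P,Q,\psi)}$. Graded Uniqueness Theorem. Suppose that there exists a uniquely maximal faithful $\psi$-compatible ideal of $R$. If $A$ is a $\mathbb Z$-graded ring and $\eta:\mathcal O_{(P,Q,\psi)}\to A$ is a graded ring homomorphism with $\eta(p_r)\ne 0$ for every $r\in R\setminus\{0\}$, then $\eta$ is injective. Moreover, such an ideal exists whenever $R$ is semiprime, i.e. whenever $I^2=\{0\}$ implies $I=\{0\}$ for every ideal $I$ of $R$. -/

import Mathlib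

open scoped RightActions

namespace CuntzPimsner

universe u v w x

/-- A bimodule over a ring `R` that need not have a unit: commuting, biadditive, associative left and
right actions on an abelian group. The right action is written `m <• r`. -/
class NUBimodule (R : Type u) (M : Type v) [NonUnitalRing R] [AddCommGroup M]
    [SMul R M] [SMul Rᵐᵒᵖ M] : Prop where
  smul_add' : ∀ (r : R) (m n : M), r • (m + n) = r • m + r • n
  add_smul' : ∀ (r s : R) (m : M), (r + s) • m = r • m + s • m
  mul_smul' : ∀ (r s : R) (m : M), (r * s) • m = r • (s • m)
  add_op' : ∀ (m n : M) (r : R), (m + n) <• r = m <• r + n <• r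
  op_add' : ∀ (m : M) (r s : R), m <• (r + s) = m <• r + m <• s
  op_mul' : ∀ (m : M) (r s : R), m <• (r * s) = (m <• r) <• s
  smul_op' : ∀ (r : R) (m : M) (s : R), (r • m) <• s = r • (m <• s)

/-- An `R`-system `(P, Q, ψ)`. An `R`-bimodule homomorphism `P ⊗_R Q → R` is given, through the
universal property of the `R`-balanced tensor product, as an `R`-balanced biadditive map that is left
`R`-linear in `P` and right `R`-linear in `Q`; `ψ p q` stands for `ψ(p ⊗ q)`. -/
structure RSystem (R : Type u) (P : Type v) (Q : Type w) [NonUnitalRing R]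
    [AddCommGroup P] [AddCommGroup Q]
  [SMul R P] [SMul Rᵐᵒᵖ P] [NUBimodule R P] [SMul R Q] [SMul Rᵐᵒᵖ Q] [NUBimodule R Q] where
  ψ : P →+ Q →+ R
  balanced : ∀ (p : P) (r : R) (q : Q), ψ (p <• r) q = ψ p (r • q)
  map_smul_left : ∀ (r : R) (p : P) (q : Q), ψ (r • p) q = r * ψ p q
  map_smul_right : ∀ (p : P) (q : Q) (r : R), ψ p (q <• r) = ψ p q * r

section

variable {R : Type u} {P : Type v} {Q : Type w} [NonUnitalRing R]
  [AddCommGroup P] [AddCommGroup Q]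
  [SMul R P] [SMul Rᵐᵒᵖ P] [NUBimodule R P] [SMul R Q] [SMul Rᵐᵒᵖ Q] [NUBimodule R Q]

namespace RSystem

/-- The rank one map `θ_{q,p} : Q → Q`, `z ↦ q ψ(p ⊗ z)`. -/
def theta (X : RSystem R P Q) (q : Q) (p : P) : Q →+ Q where
  toFun z := q <• X.ψ p z
  map_zero' := by
    have h := NUBimodule.op_add' q (0 : R) 0
    simpa using h
  map_add' a b := by rw [map_add, NUBimodule.op_add']

/-- The rank one map `θ_{p,q} : P → P`, `y ↦ ψ(y ⊗ q) p`. -/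
def theta' (X : RSystem R P Q) (p : P) (q : Q) : P →+ P where
  toFun y := X.ψ y q • p
  map_zero' := by
    have h := NUBimodule.add_smul' (0 : R) 0 p
    simpa using h
  map_add' a b := by rw [map_add, AddMonoidHom.add_apply, NUBimodule.add_smul']

/-- `F_P(Q)`: the additive span of the maps `θ_{q,p}`. -/
def finiteRank (X : RSystem R P Q) : AddSubgroup (Q →+ Q) :=
  AddSubgroup.closure {Θ | ∃ (q : Q) (p : P), Θ = X.theta q p}

/-- `F_Q(P)`: the additive span of the maps `θ_{p,q}`. -/
def finiteRank' (X : RSystem R P Q) : AddSubgroup (P →+ P) :=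
  AddSubgroup.closure {Ω | ∃ (p : P) (q : Q), Ω = X.theta' p q}

/-- Condition (FS). -/
def FS (X : RSystem R P Q) : Prop :=
  ∀ (s : Finset Q) (t : Finset P),
    (∃ Θ ∈ X.finiteRank, ∀ q ∈ s, Θ q = q) ∧ (∃ Ω ∈ X.finiteRank', ∀ p ∈ t, Ω p = p)

/-- `Δ(r) : Q → Q`, `q ↦ r q`. -/
def Delta (_X : RSystem R P Q) (r : R) : Q →+ Q where
  toFun q := r • q
  map_zero' := by
    have h := NUBimodule.smul_add' r (0 : Q) 0
    simpa using h
  map_add' a b := NUBimodule.smul_add' r a b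

/-- `J` is `ψ`-compatible: `J ⊆ Δ⁻¹(F_P(Q))`. -/
def IsCompatible (X : RSystem R P Q) (J : TwoSidedIdeal R) : Prop :=
  ∀ r ∈ J, X.Delta r ∈ X.finiteRank

/-- `J` is faithful: `J ∩ ker Δ = 0`. -/
def IsFaithful (X : RSystem R P Q) (J : TwoSidedIdeal R) : Prop :=
  ∀ r ∈ J, X.Delta r = 0 → r = 0

/-- `J` is a uniquely maximal faithful `ψ`-compatible ideal: it is faithful and `ψ`-compatible, and it
contains every faithful `ψ`-compatible ideal. -/
structure IsUniquelyMaximal (X : RSystem R P Q) (J : TwoSidedIdeal R) : Prop where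
  compatible : X.IsCompatible J
  faithful : X.IsFaithful J
  le_of_faithful : ∀ J' : TwoSidedIdeal R, X.IsCompatible J' → X.IsFaithful J' → J' ≤ J

end RSystem

/-- A covariant representation `(S, T, σ, B)` of the `R`-system `X` on the ring `B`. -/
structure CovariantRep (X : RSystem R P Q) (B : Type x) [NonUnitalRing B] where
  S : P →+ B
  T : Q →+ B
  σ : R →ₙ+* B
  S_op : ∀ (p : P) (r : R), S (p <• r) = S p * σ r
  S_smul : ∀ (r : R) (p : P), S (r • p) = σ r * S p
  T_op : ∀ (q : Q) (r : R), T (q <• r) = T q * σ r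
  T_smul : ∀ (r : R) (q : Q), T (r • q) = σ r * T q
  σ_ψ : ∀ (p : P) (q : Q), σ (X.ψ p q) = S p * T q

namespace CovariantRep

variable {X : RSystem R P Q} {B : Type x} [NonUnitalRing B]

/-- `T^m(Q^{⊗ m})` for `m ≥ 1`, the additive span of the products `T(q₁)⋯T(q_m)`; `σ(R)` for
`m = 0`. -/
def powT (C : CovariantRep X B) : ℕ → AddSubgroup B
  | 0 => C.σ.toAddMonoidHom.range
  | 1 => C.T.range
  | m + 2 => AddSubgroup.closure {b | ∃ a ∈ C.powT (m + 1), ∃ q : Q, b = a * C.T q}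

/-- `S^n(P^{⊗ n})` for `n ≥ 1`, the additive span of the products `S(p₁)⋯S(p_n)`; `σ(R)` for
`n = 0`. -/
def powS (C : CovariantRep X B) : ℕ → AddSubgroup B
  | 0 => C.σ.toAddMonoidHom.range
  | 1 => C.S.range
  | n + 2 => AddSubgroup.closure {b | ∃ a ∈ C.powS (n + 1), ∃ p : P, b = a * C.S p}

/-- `B_{(0,0)} = σ(R)`, `B_{(m,0)} = T^m(Q^{⊗ m})`, `B_{(0,n)} = S^n(P^{⊗ n})`, and
`B_{(m,n)} = span {T^m(q) S^n(p)}` for `m, n ≥ 1`. -/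
def bicomponent (C : CovariantRep X B) : ℕ → ℕ → AddSubgroup B
  | m, 0 => C.powT m
  | 0, n + 1 => C.powS (n + 1)
  | m + 1, n + 1 =>
      AddSubgroup.closure {b | ∃ a ∈ C.powT (m + 1), ∃ c ∈ C.powS (n + 1), b = a * c}

/-- `B^{(k)}`, the sum of the `B_{(m,n)}` with `m - n = k`. For the Toeplitz representation and for the
relative Cuntz-Pimsner representations this is the component of degree `k` of the canonical
`ℤ`-grading. -/
def component (C : CovariantRep X B) (k : ℤ) : AddSubgroup B :=
  ⨆ (m : ℕ) (n : ℕ) (_ : (m : ℤ) - (n : ℤ) = k), C.bicomponent m n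

/-- The graph of `π_{T,S} : F_P(Q) → B`: the additive relation generated by the pairs
`(θ_{q,p}, T(q) S(p))`. -/
def piGraph (C : CovariantRep X B) : AddSubgroup ((Q →+ Q) × B) :=
  AddSubgroup.closure {y | ∃ (q : Q) (p : P), y = (X.theta q p, C.T q * C.S p)}

open Classical in
/-- The homomorphism `π_{T,S} : F_P(Q) → B` with `π_{T,S}(θ_{q,p}) = T(q) S(p)`, set to `0` outside
`F_P(Q)`. It is well defined when `X` satisfies (FS), see `pi_eq`. -/
noncomputable def pi (C : CovariantRep X B) (Θ : Q →+ Q) : B :=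
  if h : ∃ b, (Θ, b) ∈ C.piGraph then h.choose else 0

/-- Composition of a representation with a ring homomorphism. -/
def map (C : CovariantRep X B) {B' : Type*} [NonUnitalRing B'] (f : B →ₙ+* B') :
    CovariantRep X B' where
  S := f.toAddMonoidHom.comp C.S
  T := f.toAddMonoidHom.comp C.T
  σ := f.comp C.σ
  S_op p r := by simp [C.S_op]
  S_smul r p := by simp [C.S_smul]
  T_op q r := by simp [C.T_op]
  T_smul r q := by simp [C.T_smul]
  σ_ψ p q := by simp [C.σ_ψ]

theorem exists_list_of_mem_finiteRank' {Ω : P →+ P} (h : Ω ∈ X.finiteRank') :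
    ∃ l : List (Q × P), ∀ y : P, (l.map fun c => X.ψ y c.1 • c.2).sum = Ω y := by
  refine AddSubgroup.closure_induction (p := fun Ω _ => ∃ l : List (Q × P),
    ∀ y : P, (l.map fun c => X.ψ y c.1 • c.2).sum = Ω y) ?_ ?_ ?_ ?_ h
  · rintro _ ⟨p, q, rfl⟩
    exact ⟨[(q, p)], fun y => by simp [RSystem.theta']⟩
  · exact ⟨[], fun y => by simp⟩
  · rintro a b _ _ ⟨l, hl⟩ ⟨l', hl'⟩
    exact ⟨l ++ l', fun y => by simp [hl, hl']⟩
  · rintro a _ ⟨l, hl⟩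
    refine ⟨l.map fun c => (-c.1, c.2), fun y => ?_⟩
    rw [AddMonoidHom.neg_apply, ← hl y, List.map_map]
    have key : ∀ (r : R) (p : P), (-r) • p = -(r • p) := fun r p => by
      have h0 := (X.theta' p 0).map_zero
      have h1 : (0 : R) • p = 0 := by simpa [RSystem.theta'] using h0
      have h2 := NUBimodule.add_smul' r (-r) p
      rw [add_neg_cancel, h1] at h2
      exact (neg_eq_of_add_eq_zero_right h2.symm).symm
    clear hl
    induction l with
    | nil => simp
    | cons c l ih => simp only [List.map_cons, List.sum_cons, ih, neg_add]; simp [key]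

theorem piGraph_aux (C : CovariantRep X B) {y : (Q →+ Q) × B} (h : y ∈ C.piGraph) :
    ∃ t : Finset P, ∀ l : List (Q × P),
      (∀ p ∈ t, (l.map fun c => X.ψ p c.1 • c.2).sum = p) →
        (l.map fun c => C.T (y.1 c.1) * C.S c.2).sum = y.2 := by
  classical
  refine AddSubgroup.closure_induction (p := fun (y : (Q →+ Q) × B) _ => ∃ t : Finset P,
    ∀ l : List (Q × P), (∀ p ∈ t, (l.map fun c => X.ψ p c.1 • c.2).sum = p) →
        (l.map fun c => C.T (y.1 c.1) * C.S c.2).sum = y.2) ?_ ?_ ?_ ?_ h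
  · rintro _ ⟨q, p, rfl⟩
    refine ⟨{p}, fun l hl => ?_⟩
    have h1 := hl p (by simp)
    have h2 : ∀ l : List (Q × P), (l.map fun c => C.T (X.theta q p c.1) * C.S c.2).sum
        = C.T q * C.S (l.map fun c => X.ψ p c.1 • c.2).sum := by
      intro l
      induction l with
      | nil => simp
      | cons c l ih =>
        simp only [List.map_cons, List.sum_cons, ih, map_add, mul_add]
        congr 1
        change C.T (q <• X.ψ p c.1) * _ = _
        rw [C.T_op, C.S_smul, mul_assoc]
    change (l.map fun c => C.T (X.theta q p c.1) * C.S c.2).sum = C.T q * C.S p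
    rw [h2, h1]
  · exact ⟨∅, fun l _ => by simp⟩
  · rintro a b _ _ ⟨t, ht⟩ ⟨t', ht'⟩
    refine ⟨t ∪ t', fun l hl => ?_⟩
    have h1 := ht l fun p hp => hl p (by simp [hp])
    have h2 := ht' l fun p hp => hl p (by simp [hp])
    rw [Prod.snd_add, ← h1, ← h2, ← List.sum_map_add]
    simp [add_mul]
  · rintro a _ ⟨t, ht⟩
    refine ⟨t, fun l hl => ?_⟩
    rw [Prod.snd_neg, ← ht l hl]
    clear hl
    induction l with
    | nil => simp
    | cons c l ih => simp only [List.map_cons, List.sum_cons, ih, neg_add]; simp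

/-- Under (FS), the relation `piGraph` is the graph of `pi`. -/
theorem pi_eq (C : CovariantRep X B) (hFS : X.FS) {Θ : Q →+ Q} {b : B}
    (h : (Θ, b) ∈ C.piGraph) : C.pi Θ = b := by
  have hex : ∃ b, (Θ, b) ∈ C.piGraph := ⟨b, h⟩
  have h' : (Θ, C.pi Θ) ∈ C.piGraph := by
    rw [pi, dif_pos hex]
    exact hex.choose_spec
  have hd := C.piGraph.sub_mem h' h
  obtain ⟨t, ht⟩ := C.piGraph_aux hd
  obtain ⟨Ω, hΩ, hΩt⟩ := (hFS ∅ t).2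
  obtain ⟨l, hl⟩ := exists_list_of_mem_finiteRank' hΩ
  have h3 := ht l fun p hp => by rw [hl p, hΩt p hp]
  simp only [Prod.fst_sub, sub_self, Prod.snd_sub, AddMonoidHom.zero_apply, map_zero,
    zero_mul, List.map_const', List.sum_replicate, smul_zero] at h3
  exact (sub_eq_zero.mp h3.symm)

end CovariantRep

/-- The quotient homomorphism `B → B/I` of a ring without unit. -/
def quotientHom {B : Type x} [NonUnitalRing B] (I : TwoSidedIdeal B) :
    B →ₙ+* I.ringCon.Quotient where
  toFun b := (b : I.ringCon.Quotient)
  map_mul' _ _ := rfl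
  map_zero' := rfl
  map_add' _ _ := rfl

namespace RSystem

variable (X : RSystem R P Q)

/-- The free ring (without unit) on the disjoint union of the sets `R`, `P` and `Q`. -/
abbrev FreeRng (_X : RSystem R P Q) : Type (max u v w) :=
  MonoidAlgebra ℤ (FreeSemigroup (R ⊕ P ⊕ Q))

/-- The generator `[r]`. -/
noncomputable def genR (r : R) : X.FreeRng := MonoidAlgebra.single (FreeSemigroup.of (Sum.inl r)) 1

/-- The generator `[p]`. -/
noncomputable def genP (p : P) : X.FreeRng :=
  MonoidAlgebra.single (FreeSemigroup.of (Sum.inr (Sum.inl p))) 1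

/-- The generator `[q]`. -/
noncomputable def genQ (q : Q) : X.FreeRng :=
  MonoidAlgebra.single (FreeSemigroup.of (Sum.inr (Sum.inr q))) 1

/-- The elements of the free ring that a covariant representation has to send to zero. -/
inductive Relator : X.FreeRng → Prop
  | add_R (r s : R) : Relator (X.genR (r + s) - (X.genR r + X.genR s))
  | mul_R (r s : R) : Relator (X.genR (r * s) - X.genR r * X.genR s)
  | add_P (p p' : P) : Relator (X.genP (p + p') - (X.genP p + X.genP p'))
  | add_Q (q q' : Q) : Relator (X.genQ (q + q') - (X.genQ q + X.genQ q'))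
  | op_P (p : P) (r : R) : Relator (X.genP (p <• r) - X.genP p * X.genR r)
  | smul_P (r : R) (p : P) : Relator (X.genP (r • p) - X.genR r * X.genP p)
  | op_Q (q : Q) (r : R) : Relator (X.genQ (q <• r) - X.genQ q * X.genR r)
  | smul_Q (r : R) (q : Q) : Relator (X.genQ (r • q) - X.genR r * X.genQ q)
  | psi (p : P) (q : Q) : Relator (X.genR (X.ψ p q) - X.genP p * X.genQ q)

/-- The ideal of the free ring generated by the relators. -/
noncomputable def relatorIdeal : TwoSidedIdeal X.FreeRng := TwoSidedIdeal.span {y | X.Relator y}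

/-- The Toeplitz ring `𝒯_{(P,Q,ψ)}`: the ring carrying the universal covariant representation. -/
abbrev Toeplitz : Type (max u v w) := X.relatorIdeal.ringCon.Quotient

theorem quotientHom_eq {a b : X.FreeRng} (h : X.Relator (a - b)) :
    quotientHom X.relatorIdeal a = quotientHom X.relatorIdeal b :=
  (RingCon.eq _).mpr ((TwoSidedIdeal.rel_iff _ _ _).mpr (TwoSidedIdeal.subset_span h))

/-- The Toeplitz representation `(ι_P, ι_Q, ι_R, 𝒯_{(P,Q,ψ)})`. -/
noncomputable def toeplitzRep : CovariantRep X X.Toeplitz where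
  S := AddMonoidHom.mk' (fun p => quotientHom X.relatorIdeal (X.genP p)) fun p p' => by
    rw [X.quotientHom_eq (.add_P p p'), map_add]
  T := AddMonoidHom.mk' (fun q => quotientHom X.relatorIdeal (X.genQ q)) fun q q' => by
    rw [X.quotientHom_eq (.add_Q q q'), map_add]
  σ :=
    { AddMonoidHom.mk' (fun r => quotientHom X.relatorIdeal (X.genR r)) fun r r' => by
        rw [X.quotientHom_eq (.add_R r r'), map_add] with
      map_mul' := fun r r' => by
        change quotientHom X.relatorIdeal (X.genR (r * r')) = _
        rw [X.quotientHom_eq (.mul_R r r'), map_mul]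
        rfl }
  S_op p r := by
    change quotientHom X.relatorIdeal (X.genP (p <• r)) = _
    rw [X.quotientHom_eq (.op_P p r), map_mul]; rfl
  S_smul r p := by
    change quotientHom X.relatorIdeal (X.genP (r • p)) = _
    rw [X.quotientHom_eq (.smul_P r p), map_mul]; rfl
  T_op q r := by
    change quotientHom X.relatorIdeal (X.genQ (q <• r)) = _
    rw [X.quotientHom_eq (.op_Q q r), map_mul]; rfl
  T_smul r q := by
    change quotientHom X.relatorIdeal (X.genQ (r • q)) = _
    rw [X.quotientHom_eq (.smul_Q r q), map_mul]; rfl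
  σ_ψ p q := by
    change quotientHom X.relatorIdeal (X.genR (X.ψ p q)) = _
    rw [X.quotientHom_eq (.psi p q), map_mul]; rfl

/-- The universal property of the Toeplitz representation: every covariant representation of `X` factors
through it by exactly one ring homomorphism. -/
theorem existsUnique_toeplitz_hom {B : Type x} [NonUnitalRing B] (C : CovariantRep X B) :
    ∃! η : X.Toeplitz →ₙ+* B, (∀ r, η (X.toeplitzRep.σ r) = C.σ r) ∧
      (∀ q, η (X.toeplitzRep.T q) = C.T q) ∧ (∀ p, η (X.toeplitzRep.S p) = C.S p) := by
  let g : R ⊕ P ⊕ Q → B := Sum.elim C.σ (Sum.elim C.S C.T)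
  let F : X.FreeRng →ₙₐ[ℤ] B := MonoidAlgebra.liftMagma ℤ (FreeSemigroup.lift g)
  have hF : ∀ x, F (MonoidAlgebra.single (FreeSemigroup.of x) 1) = g x := fun x => by
    simp [F, MonoidAlgebra.liftMagma]
  have hR : ∀ r, F (X.genR r) = C.σ r := fun r => hF _
  have hP : ∀ p, F (X.genP p) = C.S p := fun p => hF _
  have hQ : ∀ q, F (X.genQ q) = C.T q := fun q => hF _
  have hle : X.relatorIdeal ≤ TwoSidedIdeal.ker F := by
    refine TwoSidedIdeal.span_le.mpr fun y hy => ?_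
    rw [SetLike.mem_coe, TwoSidedIdeal.mem_ker]
    induction (show X.Relator y from hy) <;>
      simp [hR, hP, hQ, C.S_op, C.S_smul, C.T_op, C.T_smul, C.σ_ψ]
  have hwd : ∀ a b : X.FreeRng, X.relatorIdeal.ringCon a b → F a = F b := fun a b h => by
    have h1 := hle ((TwoSidedIdeal.rel_iff _ _ _).mp h)
    rw [TwoSidedIdeal.mem_ker, map_sub] at h1
    exact sub_eq_zero.mp h1
  refine ⟨{ toFun := Quotient.lift F hwd
            map_zero' := map_zero F
            map_add' := ?_
            map_mul' := ?_ }, ⟨hR, hQ, hP⟩, ?_⟩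
  · rintro ⟨a⟩ ⟨b⟩
    exact map_mul F a b
  · rintro ⟨a⟩ ⟨b⟩
    exact map_add F a b
  · rintro η ⟨h1, h2, h3⟩
    let G : X.FreeRng →ₙₐ[ℤ] B :=
      { η.comp (quotientHom X.relatorIdeal) with
        map_smul' := fun n a => map_zsmul (η.comp (quotientHom X.relatorIdeal)) n a }
    have hG : ∀ x, G (MonoidAlgebra.single (FreeSemigroup.of x) 1) = g x := by
      rintro (r | p | q)
      exacts [h1 r, h3 p, h2 q]
    have key : G = F := by
      refine MonoidAlgebra.nonUnitalAlgHom_ext' ℤ (FreeSemigroup.hom_ext (funext fun x => ?_))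
      exact (hG x).trans (hF x).symm
    ext ⟨a⟩
    exact DFunLike.congr_fun key a

/-- `𝒯(J)`: the two-sided ideal of the Toeplitz ring generated by the elements `ι_R(r) - π(Δ(r))`,
`r ∈ J`. -/
noncomputable def toeplitzIdeal (J : TwoSidedIdeal R) : TwoSidedIdeal X.Toeplitz :=
  TwoSidedIdeal.span
    {y | ∃ r ∈ J, y = X.toeplitzRep.σ r - X.toeplitzRep.pi (X.Delta r)}

/-- The Cuntz-Pimsner ring `𝒪_{(P,Q,ψ)}(J) = 𝒯_{(P,Q,ψ)}/𝒯(J)` relative to `J`. -/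
abbrev RelCuntzPimsner (J : TwoSidedIdeal R) : Type (max u v w) :=
  (X.toeplitzIdeal J).ringCon.Quotient

/-- The Cuntz-Pimsner representation `(ι_P^J, ι_Q^J, ι_R^J, 𝒪_{(P,Q,ψ)}(J))` relative to `J`. -/
noncomputable def cuntzPimsnerRep (J : TwoSidedIdeal R) :
    CovariantRep X (X.RelCuntzPimsner J) :=
  X.toeplitzRep.map (quotientHom (X.toeplitzIdeal J))

end RSystem

end

/-- A `ℤ`-grading of a ring `A` that need not have a unit: `A = ⨁ A_k` and `A_k A_l ⊆ A_{k+l}`. -/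
structure IsZGrading {A : Type x} [NonUnitalRing A] (𝒜 : ℤ → AddSubgroup A) : Prop where
  isInternal : DirectSum.IsInternal 𝒜
  mul_mem : ∀ (k l : ℤ), ∀ a ∈ 𝒜 k, ∀ b ∈ 𝒜 l, a * b ∈ 𝒜 (k + l)

/-- A ring (not necessarily with unit) is semiprime if `I² = 0` implies `I = 0` for every two-sided
ideal `I`. -/
def IsSemiprimeRing (R : Type u) [NonUnitalRing R] : Prop :=
  ∀ I : TwoSidedIdeal R, (∀ a ∈ I, ∀ b ∈ I, a * b = 0) → ∀ a ∈ I, a = 0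

end CuntzPimsner

namespace CuntzPimsner

universe u v w x y

variable {R : Type u} {P : Type v} {Q : Type w} [NonUnitalRing R]
  [AddCommGroup P] [AddCommGroup Q]
  [SMul R P] [SMul Rᵐᵒᵖ P] [NUBimodule R P] [SMul R Q] [SMul Rᵐᵒᵖ Q] [NUBimodule R Q]

/-! Elements of the Cuntz-Pimsner ring are sums of homogeneous ones, and the target grading is
direct, so a graded η is injective once it is injective on each component
(`eq_zero_of_graded_of_mem_iSup`).

If b has positive degree and η(b) = 0, each S(p)b has smaller degree and vanishes by induction; (FS)
gives a local unit e, a sum of products T(q)S(p), with eb = b, so b = 0. Negative degrees are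
symmetric.

In degree 0, induct along the filtration by B_{(0,0)} + ⋯ + B_{(N,N)} (`eq_zero_of_mem_diagonal`).
Write b = σ(r) + x, where x has local units e, f on the two sides. By induction all S(p)bT(q)
vanish, so ebf = 0 and x = -eσ(r)f. Hence -x = π(Θ) for a finite rank Θ, and η(b) = 0 forces Θ =
Δ(r). The r with ησ(r) = ηπ(Δ(r)) form a faithful ψ-compatible ideal, which lies in J by maximality.
The defining relation then gives σ(r) = π(Δ(r)) = -x, that is, b = 0.

For semiprime R, J consists of the r with Δ(r) of finite rank and r · ker Δ = 0: its intersection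
with ker Δ has square zero. -/

theorem mul_mem_of_mem_closure {B : Type x} [NonUnitalRing B] {s : Set B} {K : AddSubgroup B} {a b : B}
    (h : ∀ c ∈ s, a * c ∈ K) (hb : b ∈ AddSubgroup.closure s) : a * b ∈ K :=
  (AddSubgroup.closure_le (K.comap (AddMonoidHom.mulLeft a))).2 h hb

theorem mul_mem_of_mem_closure' {B : Type x} [NonUnitalRing B] {s : Set B} {K : AddSubgroup B} {a b : B}
    (h : ∀ c ∈ s, c * a ∈ K) (hb : b ∈ AddSubgroup.closure s) : b * a ∈ K :=
  (AddSubgroup.closure_le (K.comap (AddMonoidHom.mulRight a))).2 h hb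

/-! ### Δ and the rank one maps. -/

namespace RSystem

variable (X : RSystem R P Q)

theorem Delta_add (r s : R) : X.Delta (r + s) = X.Delta r + X.Delta s :=
  AddMonoidHom.ext fun q => NUBimodule.add_smul' r s q

theorem Delta_zero : X.Delta 0 = 0 := by
  have h := X.Delta_add 0 0
  rwa [add_zero, left_eq_add] at h

theorem Delta_neg (r : R) : X.Delta (-r) = -X.Delta r := by
  have h := X.Delta_add (-r) r
  rw [neg_add_cancel, X.Delta_zero] at h
  exact eq_neg_of_add_eq_zero_left h.symm

theorem Delta_mul (r s : R) : X.Delta (r * s) = (X.Delta r).comp (X.Delta s) :=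
  AddMonoidHom.ext fun q => NUBimodule.mul_smul' r s q

theorem Delta_comp_theta (r : R) (q : Q) (p : P) :
    (X.Delta r).comp (X.theta q p) = X.theta (r • q) p :=
  AddMonoidHom.ext fun z => (NUBimodule.smul_op' r q (X.ψ p z)).symm

theorem theta_comp_Delta (r : R) (q : Q) (p : P) :
    (X.theta q p).comp (X.Delta r) = X.theta q (p <• r) :=
  AddMonoidHom.ext fun z => congrArg (fun a => q <• a) (X.balanced p r z).symm

end RSystem

namespace CovariantRep

variable {X : RSystem R P Q} {B : Type x} [NonUnitalRing B] (C : CovariantRep X B)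

/-! ### Multiplication by generators and the bidegree. -/

section products

theorem T_mul_powT (q : Q) : ∀ (m : ℕ) {a : B}, a ∈ C.powT m → C.T q * a ∈ C.powT (m + 1)
  | 0, _, ⟨r, rfl⟩ => ⟨q <• r, C.T_op q r⟩
  | 1, _, ⟨q', rfl⟩ => AddSubgroup.subset_closure ⟨C.T q, ⟨q, rfl⟩, q', rfl⟩
  | m + 2, _, ha => mul_mem_of_mem_closure (by
      rintro _ ⟨a, ha, q', rfl⟩
      rw [← mul_assoc]
      exact AddSubgroup.subset_closure ⟨_, T_mul_powT q (m + 1) ha, q', rfl⟩) ha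

theorem powT_mul_T (q : Q) : ∀ (m : ℕ) {a : B}, a ∈ C.powT m → a * C.T q ∈ C.powT (m + 1)
  | 0, _, ⟨r, rfl⟩ => ⟨r • q, C.T_smul r q⟩
  | _ + 1, a, ha => AddSubgroup.subset_closure ⟨a, ha, q, rfl⟩

theorem σ_mul_powT (r : R) : ∀ (m : ℕ) {a : B}, a ∈ C.powT m → C.σ r * a ∈ C.powT m
  | 0, _, ⟨s, rfl⟩ => ⟨r * s, map_mul C.σ r s⟩
  | 1, _, ⟨q', rfl⟩ => ⟨r • q', C.T_smul r q'⟩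
  | m + 2, _, ha => mul_mem_of_mem_closure (by
      rintro _ ⟨a, ha, q', rfl⟩
      rw [← mul_assoc]
      exact AddSubgroup.subset_closure ⟨_, σ_mul_powT r (m + 1) ha, q', rfl⟩) ha

theorem powT_mul_σ (r : R) : ∀ (m : ℕ) {a : B}, a ∈ C.powT m → a * C.σ r ∈ C.powT m
  | 0, _, ⟨s, rfl⟩ => ⟨s * r, map_mul C.σ s r⟩
  | 1, _, ⟨q', rfl⟩ => ⟨q' <• r, C.T_op q' r⟩
  | m + 2, _, ha => mul_mem_of_mem_closure' (by
      rintro _ ⟨a, ha, q', rfl⟩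
      rw [mul_assoc, ← C.T_op]
      exact AddSubgroup.subset_closure ⟨_, ha, _, rfl⟩) ha

/-- The leading factor cancels through S(p)T(q) = σ(ψ(p ⊗ q)), and a further factor T(q') absorbs
the σ that is left. -/
theorem S_mul_powT (p : P) : ∀ (m : ℕ) {a : B}, a ∈ C.powT (m + 1) → C.S p * a ∈ C.powT m
  | 0, _, ⟨q, rfl⟩ => ⟨X.ψ p q, C.σ_ψ p q⟩
  | m + 1, _, ha => mul_mem_of_mem_closure (by
      rintro _ ⟨a, ha, q', rfl⟩
      rw [← mul_assoc]
      exact C.powT_mul_T q' m (S_mul_powT p m ha)) ha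

theorem σ_mul_powS (r : R) : ∀ (n : ℕ) {a : B}, a ∈ C.powS n → C.σ r * a ∈ C.powS n
  | 0, _, ⟨s, rfl⟩ => ⟨r * s, map_mul C.σ r s⟩
  | 1, _, ⟨p, rfl⟩ => ⟨r • p, C.S_smul r p⟩
  | n + 2, _, ha => mul_mem_of_mem_closure (by
      rintro _ ⟨a, ha, p, rfl⟩
      rw [← mul_assoc]
      exact AddSubgroup.subset_closure ⟨_, σ_mul_powS r (n + 1) ha, p, rfl⟩) ha

theorem powS_mul_σ (r : R) : ∀ (n : ℕ) {a : B}, a ∈ C.powS n → a * C.σ r ∈ C.powS n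
  | 0, _, ⟨s, rfl⟩ => ⟨s * r, map_mul C.σ s r⟩
  | 1, _, ⟨p, rfl⟩ => ⟨p <• r, C.S_op p r⟩
  | n + 2, _, ha => mul_mem_of_mem_closure' (by
      rintro _ ⟨a, ha, p, rfl⟩
      rw [mul_assoc, ← C.S_op]
      exact AddSubgroup.subset_closure ⟨_, ha, _, rfl⟩) ha

theorem S_mul_powS (p : P) : ∀ (n : ℕ) {a : B}, a ∈ C.powS n → C.S p * a ∈ C.powS (n + 1)
  | 0, _, ⟨r, rfl⟩ => ⟨p <• r, C.S_op p r⟩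
  | 1, _, ⟨p', rfl⟩ => AddSubgroup.subset_closure ⟨C.S p, ⟨p, rfl⟩, p', rfl⟩
  | n + 2, _, ha => mul_mem_of_mem_closure (by
      rintro _ ⟨a, ha, p', rfl⟩
      rw [← mul_assoc]
      exact AddSubgroup.subset_closure ⟨_, S_mul_powS p (n + 1) ha, p', rfl⟩) ha

theorem powS_mul_T (q : Q) : ∀ (n : ℕ) {a : B}, a ∈ C.powS (n + 1) → a * C.T q ∈ C.powS n
  | 0, _, ⟨p, rfl⟩ => ⟨X.ψ p q, C.σ_ψ p q⟩
  | n + 1, _, ha => mul_mem_of_mem_closure' (by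
      rintro _ ⟨a, ha, p, rfl⟩
      rw [mul_assoc, ← C.σ_ψ]
      exact C.powS_mul_σ _ _ ha) ha

theorem mul_mem_bicomponent : ∀ {m n : ℕ} {a c : B}, a ∈ C.powT m → c ∈ C.powS n →
    a * c ∈ C.bicomponent m n
  | m, 0, _, _, ha, ⟨r, rfl⟩ => by
      cases m <;> exact C.powT_mul_σ r _ ha
  | 0, n + 1, _, _, ⟨r, rfl⟩, hc => C.σ_mul_powS r (n + 1) hc
  | _ + 1, _ + 1, a, c, ha, hc => AddSubgroup.subset_closure ⟨a, ha, c, hc, rfl⟩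

theorem bicomponent_zero_left (n : ℕ) : C.bicomponent 0 n = C.powS n := by
  cases n <;> rfl

theorem bicomponent_zero_right (m : ℕ) : C.bicomponent m 0 = C.powT m := by
  cases m <;> rfl

theorem T_mul_bicomponent (q : Q) : ∀ (m n : ℕ) {a : B}, a ∈ C.bicomponent m n →
    C.T q * a ∈ C.bicomponent (m + 1) n
  | m, 0, _, ha => by
      rw [bicomponent_zero_right] at ha ⊢
      exact C.T_mul_powT q m ha
  | 0, _ + 1, _, ha => C.mul_mem_bicomponent (m := 1) ⟨q, rfl⟩ ha
  | m + 1, n + 1, _, ha => mul_mem_of_mem_closure (by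
      rintro _ ⟨a, ha, c, hc, rfl⟩
      rw [← mul_assoc]
      exact C.mul_mem_bicomponent (C.T_mul_powT q _ ha) hc) ha

theorem σ_mul_bicomponent (r : R) : ∀ (m n : ℕ) {a : B}, a ∈ C.bicomponent m n →
    C.σ r * a ∈ C.bicomponent m n
  | m, 0, _, ha => by
      rw [bicomponent_zero_right] at ha ⊢
      exact C.σ_mul_powT r m ha
  | 0, n + 1, _, ha => C.σ_mul_powS r (n + 1) ha
  | m + 1, n + 1, _, ha => mul_mem_of_mem_closure (by
      rintro _ ⟨a, ha, c, hc, rfl⟩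
      rw [← mul_assoc]
      exact C.mul_mem_bicomponent (C.σ_mul_powT r _ ha) hc) ha

theorem S_mul_bicomponent (p : P) : ∀ (m n : ℕ) {a : B}, a ∈ C.bicomponent (m + 1) n →
    C.S p * a ∈ C.bicomponent m n
  | m, 0, _, ha => by
      rw [bicomponent_zero_right] at ha ⊢
      exact C.S_mul_powT p m ha
  | m, n + 1, _, ha => mul_mem_of_mem_closure (by
      rintro _ ⟨a, ha, c, hc, rfl⟩
      rw [← mul_assoc]
      exact C.mul_mem_bicomponent (C.S_mul_powT p _ ha) hc) ha

theorem S_mul_bicomponent_zero (p : P) (n : ℕ) {a : B} (ha : a ∈ C.bicomponent 0 n) :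
    C.S p * a ∈ C.bicomponent 0 (n + 1) := by
  rw [bicomponent_zero_left] at ha ⊢
  exact C.S_mul_powS p n ha

theorem bicomponent_mul_T (q : Q) : ∀ (m n : ℕ) {a : B}, a ∈ C.bicomponent m (n + 1) →
    a * C.T q ∈ C.bicomponent m n
  | 0, n, _, ha => by
      rw [bicomponent_zero_left] at ha ⊢
      exact C.powS_mul_T q n ha
  | m + 1, n, _, ha => mul_mem_of_mem_closure' (by
      rintro _ ⟨a, ha, c, hc, rfl⟩
      rw [mul_assoc]
      exact C.mul_mem_bicomponent ha (C.powS_mul_T q _ hc)) ha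

theorem bicomponent_le_component {m n : ℕ} {k : ℤ} (h : (m : ℤ) - n = k) :
    C.bicomponent m n ≤ C.component k :=
  (le_iSup_of_le m (le_iSup_of_le n (le_iSup_of_le h le_rfl)))

theorem component_le {k : ℤ} {K : AddSubgroup B}
    (h : ∀ m n : ℕ, (m : ℤ) - n = k → C.bicomponent m n ≤ K) : C.component k ≤ K :=
  iSup_le fun m => iSup_le fun n => iSup_le fun hmn => h m n hmn

theorem S_mul_component (p : P) (k : ℕ) {a : B} (ha : a ∈ C.component (k + 1)) :
    C.S p * a ∈ C.component k := by
  refine C.component_le (K := (C.component k).comap (AddMonoidHom.mulLeft (C.S p))) ?_ ha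
  rintro (_ | m) n h a ha
  -- The case m = 0 would give -n = k + 1 > 0.
  · omega
  · exact C.bicomponent_le_component (by push_cast at h; omega) (C.S_mul_bicomponent p m n ha)

theorem component_mul_T (q : Q) (k : ℕ) {a : B} (ha : a ∈ C.component (-(k + 1))) :
    a * C.T q ∈ C.component (-k) := by
  refine C.component_le (K := (C.component (-k)).comap (AddMonoidHom.mulRight (C.T q))) ?_ ha
  rintro m (_ | n) h a ha
  · omega
  · exact C.bicomponent_le_component (by push_cast at h; omega) (C.bicomponent_mul_T q m n ha)

/-- Stability under left multiplication by each kind of generator suffices to reach every word in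
the generators. -/
theorem σ_mul_iSup_component (r : R) {a : B} (ha : a ∈ ⨆ k, C.component k) :
    C.σ r * a ∈ ⨆ k, C.component k := by
  refine (iSup_le fun k => C.component_le
    (K := (⨆ k, C.component k).comap (AddMonoidHom.mulLeft (C.σ r))) ?_) ha
  intro m n _ a ha
  exact le_iSup C.component (m - n : ℤ)
    (C.bicomponent_le_component rfl (C.σ_mul_bicomponent r m n ha))

theorem T_mul_iSup_component (q : Q) {a : B} (ha : a ∈ ⨆ k, C.component k) :
    C.T q * a ∈ ⨆ k, C.component k := by
  refine (iSup_le fun k => C.component_le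
    (K := (⨆ k, C.component k).comap (AddMonoidHom.mulLeft (C.T q))) ?_) ha
  intro m n _ a ha
  exact le_iSup C.component ((m + 1 : ℕ) - n : ℤ)
    (C.bicomponent_le_component rfl (C.T_mul_bicomponent q m n ha))

theorem S_mul_iSup_component (p : P) {a : B} (ha : a ∈ ⨆ k, C.component k) :
    C.S p * a ∈ ⨆ k, C.component k := by
  refine (iSup_le fun k => C.component_le
    (K := (⨆ k, C.component k).comap (AddMonoidHom.mulLeft (C.S p))) ?_) ha
  -- For m = 0 there is no T to cancel, and the second index grows instead.
  rintro (_ | m) n _ a ha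
  · exact le_iSup C.component ((0 : ℕ) - (n + 1 : ℕ) : ℤ)
      (C.bicomponent_le_component rfl (C.S_mul_bicomponent_zero p n ha))
  · exact le_iSup C.component (m - n : ℤ)
      (C.bicomponent_le_component rfl (C.S_mul_bicomponent p m n ha))

end products

/-! ### Local units from (FS), and the graph of π. -/

section localUnits

/-- The additive span of the products `T(q) S(p)`. -/
def rankOneSpan : AddSubgroup B :=
  AddSubgroup.closure {b | ∃ (q : Q) (p : P), b = C.T q * C.S p}

theorem snd_mem_rankOneSpan {y : (Q →+ Q) × B} (hy : y ∈ C.piGraph) : y.2 ∈ C.rankOneSpan := by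
  refine (AddSubgroup.closure_le (C.rankOneSpan.comap (AddMonoidHom.snd (Q →+ Q) B))).2 ?_ hy
  rintro _ ⟨q, p, rfl⟩
  exact AddSubgroup.subset_closure ⟨q, p, rfl⟩

theorem exists_mem_piGraph_of_mem_rankOneSpan {b : B} (hb : b ∈ C.rankOneSpan) :
    ∃ Θ, (Θ, b) ∈ C.piGraph := by
  have : b ∈ C.piGraph.map (AddMonoidHom.snd (Q →+ Q) B) := by
    refine (AddSubgroup.closure_le _).2 ?_ hb
    rintro _ ⟨q, p, rfl⟩
    exact ⟨_, AddSubgroup.subset_closure ⟨q, p, rfl⟩, rfl⟩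
  obtain ⟨⟨Θ, _⟩, h, rfl⟩ := this
  exact ⟨Θ, h⟩

theorem exists_mem_piGraph_of_mem_finiteRank {Θ : Q →+ Q} (h : Θ ∈ X.finiteRank) :
    ∃ b, (Θ, b) ∈ C.piGraph := by
  have : Θ ∈ C.piGraph.map (AddMonoidHom.fst (Q →+ Q) B) := by
    refine (AddSubgroup.closure_le _).2 ?_ h
    rintro _ ⟨q, p, rfl⟩
    exact ⟨_, AddSubgroup.subset_closure ⟨q, p, rfl⟩, rfl⟩
  obtain ⟨⟨Θ', b⟩, hb, hΘ⟩ := this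
  obtain rfl : Θ' = Θ := hΘ
  exact ⟨b, hb⟩

theorem fst_mem_finiteRank {y : (Q →+ Q) × B} (hy : y ∈ C.piGraph) : y.1 ∈ X.finiteRank := by
  refine (AddSubgroup.closure_le (X.finiteRank.comap (AddMonoidHom.fst (Q →+ Q) B))).2 ?_ hy
  rintro _ ⟨q, p, rfl⟩
  exact AddSubgroup.subset_closure ⟨q, p, rfl⟩

/-- This is π(Θ)T(q) = T(Θ(q)), which on θ_{q',p} is the relation S(p)T(q) = σ(ψ(p ⊗ q)). It turns a
Θ fixing q into a left unit for T(q). -/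
theorem piGraph_mul_T {y : (Q →+ Q) × B} (hy : y ∈ C.piGraph) (q : Q) :
    y.2 * C.T q = C.T (y.1 q) := by
  induction hy using AddSubgroup.closure_induction with
  | mem y hy =>
    obtain ⟨q', p, rfl⟩ := hy
    change C.T q' * C.S p * C.T q = C.T (q' <• X.ψ p q)
    rw [C.T_op, C.σ_ψ, mul_assoc]
  | zero => simp
  | add y z _ _ h1 h2 => simp [add_mul, h1, h2]
  | neg y _ h => simp [h]

/-- θ_{p',q} is realised by right multiplication by T(q)S(p'), so both halves of (FS) produce units
in the same subgroup. -/
theorem exists_S_mul_eq {Ω : P →+ P} (h : Ω ∈ X.finiteRank') :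
    ∃ e ∈ C.rankOneSpan, ∀ p, C.S p * e = C.S (Ω p) := by
  induction h using AddSubgroup.closure_induction with
  | mem y hy =>
    obtain ⟨p', q, rfl⟩ := hy
    refine ⟨C.T q * C.S p', AddSubgroup.subset_closure ⟨q, p', rfl⟩, fun p => ?_⟩
    change _ = C.S (X.ψ p q • p')
    rw [C.S_smul, C.σ_ψ, mul_assoc]
  | zero => exact ⟨0, zero_mem _, by simp⟩
  | add y z _ _ h1 h2 =>
    obtain ⟨e, he, h1⟩ := h1
    obtain ⟨f, hf, h2⟩ := h2
    exact ⟨e + f, add_mem he hf, by simp [mul_add, h1, h2]⟩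
  | neg y _ h =>
    obtain ⟨e, he, h⟩ := h
    exact ⟨-e, neg_mem he, by simp [h]⟩

/-- The elements `a` that are fixed under left multiplication by every `e` fixing a suitable finite
set of elements `T(q)`. -/
def leftUnital : AddSubgroup B where
  carrier := {a | ∃ t : Finset Q, ∀ e : B, (∀ q ∈ t, e * C.T q = C.T q) → e * a = a}
  zero_mem' := ⟨∅, fun e _ => mul_zero e⟩
  add_mem' := by
    classical
    rintro a b ⟨s, hs⟩ ⟨t, ht⟩
    -- Quantifying over every e that fixes a finite set, rather than choosing one e per element,
    -- lets a sum be handled by the union of the two sets.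
    refine ⟨s ∪ t, fun e he => ?_⟩
    rw [mul_add, hs e fun q hq => he q (by simp [hq]), ht e fun q hq => he q (by simp [hq])]
  neg_mem' := by
    rintro a ⟨s, hs⟩
    exact ⟨s, fun e he => by rw [mul_neg, hs e he]⟩

/-- The elements `a` that are fixed under right multiplication by every `e` fixing a suitable finite
set of elements `S(p)`. -/
def rightUnital : AddSubgroup B where
  carrier := {a | ∃ t : Finset P, ∀ e : B, (∀ p ∈ t, C.S p * e = C.S p) → a * e = a}
  zero_mem' := ⟨∅, fun e _ => zero_mul e⟩
  add_mem' := by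
    classical
    rintro a b ⟨s, hs⟩ ⟨t, ht⟩
    refine ⟨s ∪ t, fun e he => ?_⟩
    rw [add_mul, hs e fun q hq => he q (by simp [hq]), ht e fun q hq => he q (by simp [hq])]
  neg_mem' := by
    rintro a ⟨s, hs⟩
    exact ⟨s, fun e he => by rw [neg_mul, hs e he]⟩

theorem leftUnital_mul {a : B} (ha : a ∈ C.leftUnital) (b : B) : a * b ∈ C.leftUnital := by
  obtain ⟨t, ht⟩ := ha
  exact ⟨t, fun e he => by rw [← mul_assoc, ht e he]⟩

theorem mul_rightUnital {a : B} (ha : a ∈ C.rightUnital) (b : B) : b * a ∈ C.rightUnital := by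
  obtain ⟨t, ht⟩ := ha
  exact ⟨t, fun e he => by rw [mul_assoc, ht e he]⟩

theorem powT_le_leftUnital : ∀ m : ℕ, C.powT (m + 1) ≤ C.leftUnital
  | 0 => by
    rintro _ ⟨q, rfl⟩
    exact ⟨{q}, fun e he => he q (by simp)⟩
  | m + 1 => (AddSubgroup.closure_le _).2 (by
    rintro _ ⟨a, ha, q, rfl⟩
    exact C.leftUnital_mul (powT_le_leftUnital m ha) _)

theorem S_mem_rightUnital (p : P) : C.S p ∈ C.rightUnital :=
  ⟨{p}, fun e he => he p (by simp)⟩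

theorem powS_le_rightUnital : ∀ n : ℕ, C.powS (n + 1) ≤ C.rightUnital
  | 0 => by
    rintro _ ⟨p, rfl⟩
    exact C.S_mem_rightUnital p
  | n + 1 => (AddSubgroup.closure_le _).2 (by
    rintro _ ⟨a, ha, p, rfl⟩
    exact C.mul_rightUnital (C.S_mem_rightUnital p) _)

theorem bicomponent_le_leftUnital (m : ℕ) : ∀ n : ℕ, C.bicomponent (m + 1) n ≤ C.leftUnital
  | 0 => C.powT_le_leftUnital m
  | n + 1 => (AddSubgroup.closure_le _).2 (by
    rintro _ ⟨a, ha, c, hc, rfl⟩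
    exact C.leftUnital_mul (C.powT_le_leftUnital m ha) _)

theorem bicomponent_le_rightUnital (n : ℕ) : ∀ m : ℕ, C.bicomponent m (n + 1) ≤ C.rightUnital
  | 0 => C.powS_le_rightUnital n
  | m + 1 => (AddSubgroup.closure_le _).2 (by
    rintro _ ⟨a, ha, c, hc, rfl⟩
    exact C.mul_rightUnital (C.powS_le_rightUnital n hc) _)

variable {C}

theorem exists_mul_eq_of_mem_leftUnital (hFS : X.FS) {a : B} (ha : a ∈ C.leftUnital) :
    ∃ e ∈ C.rankOneSpan, e * a = a := by
  obtain ⟨t, ht⟩ := ha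
  obtain ⟨Θ, hΘ, hΘt⟩ := (hFS t ∅).1
  obtain ⟨e, he⟩ := C.exists_mem_piGraph_of_mem_finiteRank hΘ
  refine ⟨e, C.snd_mem_rankOneSpan he, ht e fun q hq => ?_⟩
  rw [C.piGraph_mul_T he q, hΘt q hq]

theorem exists_mul_eq_of_mem_rightUnital (hFS : X.FS) {a : B} (ha : a ∈ C.rightUnital) :
    ∃ e ∈ C.rankOneSpan, a * e = a := by
  obtain ⟨t, ht⟩ := ha
  obtain ⟨Ω, hΩ, hΩt⟩ := (hFS ∅ t).2
  obtain ⟨e, he, h⟩ := C.exists_S_mul_eq hΩ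
  exact ⟨e, he, ht e fun p hp => by rw [h p, hΩt p hp]⟩

theorem rankOneSpan_mul_eq_zero {b e : B} (he : e ∈ C.rankOneSpan) (h : ∀ p, C.S p * b = 0) :
    e * b = 0 := by
  refine mul_mem_of_mem_closure' (K := ⊥) ?_ he
  rintro _ ⟨q, p, rfl⟩
  rw [AddSubgroup.mem_bot, mul_assoc, h p, mul_zero]

theorem mul_rankOneSpan_eq_zero {b e : B} (he : e ∈ C.rankOneSpan) (h : ∀ q, b * C.T q = 0) :
    b * e = 0 := by
  refine mul_mem_of_mem_closure (K := ⊥) ?_ he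
  rintro _ ⟨q, p, rfl⟩
  rw [AddSubgroup.mem_bot, ← mul_assoc, h q, zero_mul]

theorem rankOneSpan_mul_σ {e : B} (he : e ∈ C.rankOneSpan) (r : R) :
    e * C.σ r ∈ C.rankOneSpan := by
  refine mul_mem_of_mem_closure' ?_ he
  rintro _ ⟨q, p, rfl⟩
  rw [mul_assoc, ← C.S_op]
  exact AddSubgroup.subset_closure ⟨_, _, rfl⟩

theorem rankOneSpan_mul {e f : B} (he : e ∈ C.rankOneSpan) (hf : f ∈ C.rankOneSpan) :
    e * f ∈ C.rankOneSpan := by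
  refine mul_mem_of_mem_closure ?_ hf
  rintro _ ⟨q, p, rfl⟩
  obtain ⟨Θ, hΘ⟩ := C.exists_mem_piGraph_of_mem_rankOneSpan he
  rw [← mul_assoc, C.piGraph_mul_T hΘ]
  exact AddSubgroup.subset_closure ⟨_, _, rfl⟩

/-- On the graph this reads σ(r)π(Θ) = π(Δ(r)Θ). With its right-hand counterpart it yields the ideal
property of the subsets of R defined through finite rank. -/
theorem Delta_comp_mem_piGraph (r : R) {y : (Q →+ Q) × B} (hy : y ∈ C.piGraph) :
    ((X.Delta r).comp y.1, C.σ r * y.2) ∈ C.piGraph := by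
  induction hy using AddSubgroup.closure_induction with
  | mem y hy =>
    obtain ⟨q, p, rfl⟩ := hy
    rw [X.Delta_comp_theta, ← mul_assoc, ← C.T_smul]
    exact AddSubgroup.subset_closure ⟨_, _, rfl⟩
  | zero => simp [← Prod.zero_eq_mk, zero_mem]
  | add y z _ _ h1 h2 =>
    rw [Prod.fst_add, Prod.snd_add, AddMonoidHom.comp_add, mul_add]
    exact add_mem h1 h2
  | neg y _ h =>
    rw [Prod.fst_neg, Prod.snd_neg, AddMonoidHom.comp_neg, mul_neg]
    exact neg_mem h

theorem comp_Delta_mem_piGraph (r : R) {y : (Q →+ Q) × B} (hy : y ∈ C.piGraph) :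
    (y.1.comp (X.Delta r), y.2 * C.σ r) ∈ C.piGraph := by
  induction hy using AddSubgroup.closure_induction with
  | mem y hy =>
    obtain ⟨q, p, rfl⟩ := hy
    rw [X.theta_comp_Delta, mul_assoc, ← C.S_op]
    exact AddSubgroup.subset_closure ⟨_, _, rfl⟩
  | zero => simp [← Prod.zero_eq_mk, zero_mem]
  | add y z _ _ h1 h2 =>
    rw [Prod.fst_add, Prod.snd_add, AddMonoidHom.add_comp, add_mul]
    exact add_mem h1 h2
  | neg y _ h =>
    rw [Prod.fst_neg, Prod.snd_neg, neg_mul]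
    exact neg_mem h

theorem map_mem_piGraph {B' : Type y} [NonUnitalRing B'] (f : B →ₙ+* B') {z : (Q →+ Q) × B}
    (hz : z ∈ C.piGraph) : (z.1, f z.2) ∈ (C.map f).piGraph := by
  induction hz using AddSubgroup.closure_induction with
  | mem z hz =>
    obtain ⟨q, p, rfl⟩ := hz
    exact AddSubgroup.subset_closure ⟨q, p, Prod.ext rfl (map_mul f _ _)⟩
  | zero => simp [← Prod.zero_eq_mk, zero_mem]
  | add y z _ _ h1 h2 => simpa using add_mem h1 h2
  | neg y _ h => simpa using neg_mem h

/-- If T(q) = 0 then σ(ψ(p ⊗ q)) = S(p)T(q) = 0 for all p, so every finite rank map kills q,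
including one that fixes it. -/
theorem T_eq_zero_of_σ_injective (hFS : X.FS) (hσ : ∀ r, C.σ r = 0 → r = 0) {q : Q}
    (hq : C.T q = 0) : q = 0 := by
  obtain ⟨Θ, hΘ, hΘq⟩ := (hFS {q} ∅).1
  rw [← hΘq q (by simp)]
  have : X.finiteRank ≤ (AddMonoidHom.eval q).ker := by
    refine (AddSubgroup.closure_le _).2 ?_
    rintro _ ⟨q', p, rfl⟩
    have h0 : X.ψ p q = 0 := hσ _ (by rw [C.σ_ψ, hq, mul_zero])
    have h1 := (X.theta q' p).map_zero
    change q' <• X.ψ p q = 0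
    rw [h0]
    simpa [RSystem.theta] using h1
  exact this hΘ

end localUnits

/-! ### Injectivity on homogeneous components. -/

section uniqueness

variable {A : Type y} [NonUnitalRing A] (C : CovariantRep X B)

/-- The ideal of those `r` with `Δ(r) ∈ F_P(Q)` on whose `σ(r) - π(Δ(r))` the homomorphism `η`
vanishes. -/
def coisometricIdeal (η : B →ₙ+* A) : TwoSidedIdeal R :=
  TwoSidedIdeal.mk' {r | ∃ b, (X.Delta r, b) ∈ C.piGraph ∧ η (C.σ r) = η b}
    ⟨0, by rw [X.Delta_zero]; exact zero_mem C.piGraph, by simp⟩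
    (by
      rintro r s ⟨b, hb, hr⟩ ⟨c, hc, hs⟩
      refine ⟨b + c, ?_, by simp [hr, hs]⟩
      rw [X.Delta_add]
      exact add_mem hb hc)
    (by
      rintro r ⟨b, hb, hr⟩
      refine ⟨-b, ?_, by simp [hr]⟩
      rw [X.Delta_neg]
      exact neg_mem hb)
    (by
      rintro s r ⟨b, hb, hr⟩
      refine ⟨C.σ s * b, ?_, by simp [hr]⟩
      rw [X.Delta_mul]
      exact Delta_comp_mem_piGraph s hb)
    (by
      rintro r s ⟨b, hb, hr⟩
      refine ⟨b * C.σ s, ?_, by simp [hr]⟩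
      rw [X.Delta_mul]
      exact comp_Delta_mem_piGraph s hb)

variable {C}

theorem mem_coisometricIdeal {η : B →ₙ+* A} {r : R} :
    r ∈ C.coisometricIdeal η ↔ ∃ b, (X.Delta r, b) ∈ C.piGraph ∧ η (C.σ r) = η b :=
  TwoSidedIdeal.mem_mk' _ _ _ _ _ _ _

/-- Faithfulness: Δ(r) = 0 gives π(Δ(r)) = 0, so ησ(r) = 0 and r = 0. Maximality of J does the rest.
-/
theorem coisometricIdeal_le (hFS : X.FS) {J : TwoSidedIdeal R} (hJ : X.IsUniquelyMaximal J)
    {η : B →ₙ+* A} (hη : ∀ r, η (C.σ r) = 0 → r = 0) : C.coisometricIdeal η ≤ J := by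
  refine hJ.le_of_faithful _ (fun r hr => ?_) fun r hr h0 => ?_
  · obtain ⟨b, hb, -⟩ := mem_coisometricIdeal.1 hr
    exact C.fst_mem_finiteRank hb
  · obtain ⟨b, hb, h⟩ := mem_coisometricIdeal.1 hr
    rw [h0] at hb
    have : b = 0 := (C.pi_eq hFS hb).symm.trans (C.pi_eq hFS (zero_mem C.piGraph))
    exact hη r (by rw [h, this, map_zero])

variable (C) in
/-- `B_{(0,0)} + B_{(1,1)} + ⋯ + B_{(N,N)}`. -/
def diagonal : ℕ → AddSubgroup B
  | 0 => C.bicomponent 0 0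
  | N + 1 => diagonal N ⊔ C.bicomponent (N + 1) (N + 1)

theorem diagonal_mono : Monotone C.diagonal :=
  monotone_nat_of_le_succ fun N =>
    show C.diagonal N ≤ C.diagonal N ⊔ C.bicomponent (N + 1) (N + 1) from le_sup_left

theorem bicomponent_le_diagonal : ∀ N : ℕ, C.bicomponent N N ≤ C.diagonal N
  | 0 => le_rfl
  | _ + 1 => le_sup_right

theorem component_zero_le : C.component 0 ≤ ⨆ N, C.diagonal N :=
  C.component_le fun m n h => by
    obtain rfl : m = n := by omega
    exact (bicomponent_le_diagonal m).trans (le_iSup C.diagonal m)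

/-- Compression by S(p) and T(q) lowers both indices by one, except that B_{(0,0)} is kept in place:
S(p)σ(r)T(q) = σ(ψ(pr ⊗ q)). -/
theorem S_mul_diagonal_mul_T (p : P) (q : Q) (N : ℕ) {b : B} (hb : b ∈ C.diagonal (N + 1)) :
    C.S p * b * C.T q ∈ C.diagonal N := by
  have hsucc : ∀ (N : ℕ), ∀ b ∈ C.bicomponent (N + 1) (N + 1),
      C.S p * b * C.T q ∈ C.diagonal N := fun N b hb =>
    bicomponent_le_diagonal N (C.bicomponent_mul_T q _ _ (C.S_mul_bicomponent p _ _ hb))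
  induction N generalizing b with
  | zero =>
    obtain ⟨_, ⟨r, rfl⟩, d, hd, rfl⟩ := AddSubgroup.mem_sup.1 hb
    rw [mul_add, add_mul]
    refine add_mem ⟨X.ψ (p <• r) q, (C.σ_ψ _ _).trans ?_⟩ (hsucc 0 d hd)
    rw [C.S_op]; rfl
  | succ N ih =>
    obtain ⟨c, hc, d, hd, rfl⟩ := AddSubgroup.mem_sup.1 hb
    rw [mul_add, add_mul]
    exact add_mem (diagonal_mono N.le_succ (ih hc)) (hsucc (N + 1) d hd)

/-- The term σ(r) need not have local units of the form ∑ T(q)S(p), so it is split off from the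
terms that do. -/
theorem exists_eq_σ_add_of_mem_diagonal : ∀ (N : ℕ) {b : B}, b ∈ C.diagonal N →
    ∃ r : R, ∃ x ∈ C.leftUnital ⊓ C.rightUnital, b = C.σ r + x
  | 0, _, ⟨r, hr⟩ => ⟨r, 0, zero_mem _, by rw [add_zero]; exact hr.symm⟩
  | N + 1, b, hb => by
    obtain ⟨c, hc, d, hd, rfl⟩ := AddSubgroup.mem_sup.1 hb
    obtain ⟨r, x, hx, rfl⟩ := exists_eq_σ_add_of_mem_diagonal N hc
    exact ⟨r, x + d, add_mem hx ⟨C.bicomponent_le_leftUnital _ _ hd,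
      C.bicomponent_le_rightUnital _ _ hd⟩, add_assoc _ _ _⟩

variable (hFS : X.FS) {J : TwoSidedIdeal R} (hJ : X.IsUniquelyMaximal J)
  (hC : ∀ r ∈ J, ∀ b, (X.Delta r, b) ∈ C.piGraph → C.σ r = b)
  {η : B →ₙ+* A} (hη : ∀ r, η (C.σ r) = 0 → r = 0)

include hFS hJ hC hη

theorem eq_zero_of_mem_diagonal (N : ℕ) {b : B} (hb : b ∈ C.diagonal N) (h0 : η b = 0) : b = 0 := by
  induction N generalizing b with
  | zero =>
    obtain ⟨r, rfl⟩ := hb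
    rw [hη r h0, map_zero]
  | succ N ih =>
    have hpq : ∀ p q, C.S p * b * C.T q = 0 := fun p q =>
      ih (S_mul_diagonal_mul_T p q N hb) (by rw [map_mul, map_mul, h0, mul_zero, zero_mul])
    obtain ⟨r, x, hx, rfl⟩ := exists_eq_σ_add_of_mem_diagonal _ hb
    obtain ⟨e, he, hex⟩ := exists_mul_eq_of_mem_leftUnital hFS hx.1
    obtain ⟨f, hf, hxf⟩ := exists_mul_eq_of_mem_rightUnital hFS hx.2
    -- Here e ends in factors S(p) and f begins with factors T(q), so only the vanishing
    -- compressions occur.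
    have hef : e * (C.σ r + x) * f = 0 :=
      mul_rankOneSpan_eq_zero hf fun q => by
        rw [mul_assoc]
        exact rankOneSpan_mul_eq_zero he fun p => by rw [← mul_assoc, hpq p q]
    rw [mul_add, add_mul, hex, hxf] at hef
    have hc : -x ∈ C.rankOneSpan := by
      rw [← eq_neg_of_add_eq_zero_left hef]
      exact rankOneSpan_mul (rankOneSpan_mul_σ he r) hf
    obtain ⟨Θ, hΘ⟩ := C.exists_mem_piGraph_of_mem_rankOneSpan hc
    have hr : η (C.σ r) = η (-x) := by
      rw [map_add] at h0
      rw [map_neg, eq_neg_of_add_eq_zero_left h0]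
    have hΔ : X.Delta r = Θ := by
      refine AddMonoidHom.ext fun q => sub_eq_zero.1 ?_
      -- The representation composed with η still has injective σ, so Δ(r) and Θ may be compared
      -- after applying η.
      refine T_eq_zero_of_σ_injective (C := C.map η) hFS hη ?_
      change η (C.T (r • q - Θ q)) = 0
      rw [map_sub, C.T_smul, ← C.piGraph_mul_T hΘ, map_sub, map_mul, map_mul, hr, sub_self]
    rw [← hΔ] at hΘ
    have hrJ : r ∈ J := coisometricIdeal_le hFS hJ hη (mem_coisometricIdeal.2 ⟨_, hΘ, hr⟩)
    rw [hC r hrJ _ hΘ, neg_add_cancel]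

theorem eq_zero_of_mem_component_zero {b : B} (hb : b ∈ C.component 0) (h0 : η b = 0) : b = 0 := by
  obtain ⟨N, hN⟩ := (AddSubgroup.mem_iSup_of_directed diagonal_mono.directed_le).1
    (component_zero_le hb)
  exact eq_zero_of_mem_diagonal hFS hJ hC hη N hN h0

theorem eq_zero_of_mem_component_natCast (k : ℕ) {b : B} (hb : b ∈ C.component k) (h0 : η b = 0) :
    b = 0 := by
  induction k generalizing b with
  | zero => exact eq_zero_of_mem_component_zero hFS hJ hC hη hb h0
  | succ k ih =>
    rw [Nat.cast_succ] at hb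
    have hl : C.component (k + 1) ≤ C.leftUnital := C.component_le fun m n h => by
      -- Positive degree forces m ≥ 1, so a left local unit is available.
      obtain ⟨m, rfl⟩ : ∃ m', m = m' + 1 := ⟨m - 1, by omega⟩
      exact C.bicomponent_le_leftUnital m n
    obtain ⟨e, he, heb⟩ := exists_mul_eq_of_mem_leftUnital hFS (hl hb)
    rw [← heb]
    exact rankOneSpan_mul_eq_zero he fun p =>
      ih (C.S_mul_component p k hb) (by rw [map_mul, h0, mul_zero])

theorem eq_zero_of_mem_component_neg_natCast (k : ℕ) {b : B} (hb : b ∈ C.component (-k))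
    (h0 : η b = 0) : b = 0 := by
  induction k generalizing b with
  | zero => exact eq_zero_of_mem_component_zero hFS hJ hC hη hb h0
  | succ k ih =>
    rw [Nat.cast_succ] at hb
    have hl : C.component (-(k + 1)) ≤ C.rightUnital := C.component_le fun m n h => by
      obtain ⟨n, rfl⟩ : ∃ n', n = n' + 1 := ⟨n - 1, by omega⟩
      exact C.bicomponent_le_rightUnital n m
    obtain ⟨e, he, heb⟩ := exists_mul_eq_of_mem_rightUnital hFS (hl hb)
    rw [← heb]
    exact mul_rankOneSpan_eq_zero he fun q =>
      ih (C.component_mul_T q k hb) (by rw [map_mul, h0, zero_mul])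

theorem eq_zero_of_mem_component (k : ℤ) {b : B} (hb : b ∈ C.component k) (h0 : η b = 0) :
    b = 0 := by
  obtain ⟨n, rfl | rfl⟩ := k.eq_nat_or_neg
  · exact eq_zero_of_mem_component_natCast hFS hJ hC hη n hb h0
  · exact eq_zero_of_mem_component_neg_natCast hFS hJ hC hη n hb h0

end uniqueness

end CovariantRep

/-! ### The Cuntz-Pimsner ring, and the ideal for semiprime R. -/

namespace RSystem

variable (X : RSystem R P Q)

/-- The free ring is additively spanned by words and maps onto the quotient; a word is handled by
peeling off its first letter. -/
theorem mem_iSup_component_cuntzPimsnerRep (J : TwoSidedIdeal R) (b : X.RelCuntzPimsner J) :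
    b ∈ ⨆ k, (X.cuntzPimsnerRep J).component k := by
  set C := X.cuntzPimsnerRep J
  let f : X.FreeRng →ₙ+* X.RelCuntzPimsner J :=
    (quotientHom (X.toeplitzIdeal J)).comp (quotientHom X.relatorIdeal)
  have hf : Function.Surjective f :=
    (Quotient.mk_surjective).comp (Quotient.mk_surjective)
  obtain ⟨z, rfl⟩ := hf b
  have key : ∀ w : FreeSemigroup (R ⊕ P ⊕ Q),
      f (MonoidAlgebra.single w 1) ∈ ⨆ k, C.component k := by
    intro w
    induction w using FreeSemigroup.recOnMul with
    | ih1 x =>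
      obtain r | p | q := x
      · exact le_iSup C.component _ (C.bicomponent_le_component (m := 0) (n := 0) rfl ⟨r, rfl⟩)
      · exact le_iSup C.component _ (C.bicomponent_le_component (m := 0) (n := 1) rfl ⟨p, rfl⟩)
      · exact le_iSup C.component _ (C.bicomponent_le_component (m := 1) (n := 0) rfl ⟨q, rfl⟩)
    | ih2 x w _ hw =>
      have : (MonoidAlgebra.single (FreeSemigroup.of x * w) 1 : X.FreeRng)
          = MonoidAlgebra.single (FreeSemigroup.of x) 1 * MonoidAlgebra.single w 1 := by
        rw [MonoidAlgebra.single_mul_single, one_mul]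
      rw [this, map_mul]
      obtain r | p | q := x
      · exact C.σ_mul_iSup_component r hw
      · exact C.S_mul_iSup_component p hw
      · exact C.T_mul_iSup_component q hw
  induction z using MonoidAlgebra.induction_linear with
  | zero => rw [map_zero]; exact zero_mem _
  | add a b ha hb => rw [map_add]; exact add_mem ha hb
  | single w n =>
    have : (MonoidAlgebra.single w n : X.FreeRng) = n • MonoidAlgebra.single w 1 := by
      rw [MonoidAlgebra.smul_single, smul_eq_mul, mul_one]
    rw [this, map_zsmul]
    exact zsmul_mem (key w) n

/-- The relation is imposed with the Toeplitz π. Pushing its graph to the quotient, where (FS) makes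
π single-valued, transfers it to the π of the quotient representation. -/
theorem cuntzPimsnerRep_σ_eq (hFS : X.FS) {J : TwoSidedIdeal R} (hJ : X.IsCompatible J) {r : R}
    (hr : r ∈ J) {b : X.RelCuntzPimsner J}
    (hb : (X.Delta r, b) ∈ (X.cuntzPimsnerRep J).piGraph) : (X.cuntzPimsnerRep J).σ r = b := by
  obtain ⟨c, hc⟩ := X.toeplitzRep.exists_mem_piGraph_of_mem_finiteRank (hJ r hr)
  have h1 := CovariantRep.map_mem_piGraph (quotientHom (X.toeplitzIdeal J)) hc
  rw [← CovariantRep.pi_eq _ hFS hb]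
  refine Eq.trans ?_ (CovariantRep.pi_eq _ hFS h1).symm
  refine (RingCon.eq _).mpr ((TwoSidedIdeal.rel_iff _ _ _).mpr (TwoSidedIdeal.subset_span ?_))
  exact ⟨r, hr, by rw [X.toeplitzRep.pi_eq hFS hc]; rfl⟩

/-- The ideal of those `r` with `Δ(r) ∈ F_P(Q)` that annihilate `ker Δ` from the left. -/
def annihilatorIdeal : TwoSidedIdeal R :=
  TwoSidedIdeal.mk' {r | X.Delta r ∈ X.finiteRank ∧ ∀ s, X.Delta s = 0 → r * s = 0}
    ⟨by rw [X.Delta_zero]; exact zero_mem _, fun s _ => zero_mul s⟩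
    (by
      rintro r s ⟨hr, hr'⟩ ⟨hs, hs'⟩
      refine ⟨?_, fun t ht => by rw [add_mul, hr' t ht, hs' t ht, add_zero]⟩
      rw [X.Delta_add]
      exact add_mem hr hs)
    (by
      rintro r ⟨hr, hr'⟩
      refine ⟨?_, fun t ht => by rw [neg_mul, hr' t ht, neg_zero]⟩
      rw [X.Delta_neg]
      exact neg_mem hr)
    (by
      rintro s r ⟨hr, hr'⟩
      refine ⟨?_, fun t ht => by rw [mul_assoc, hr' t ht, mul_zero]⟩
      rw [X.Delta_mul]
      -- The Toeplitz graph serves only to show that finite rank maps are stable under composition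
      -- with Δ(s).
      obtain ⟨b, hb⟩ := X.toeplitzRep.exists_mem_piGraph_of_mem_finiteRank hr
      exact CovariantRep.fst_mem_finiteRank _ (CovariantRep.Delta_comp_mem_piGraph s hb))
    (by
      rintro r s ⟨hr, hr'⟩
      refine ⟨?_, fun t ht => ?_⟩
      · rw [X.Delta_mul]
        obtain ⟨b, hb⟩ := X.toeplitzRep.exists_mem_piGraph_of_mem_finiteRank hr
        exact CovariantRep.fst_mem_finiteRank _ (CovariantRep.comp_Delta_mem_piGraph s hb)
      · rw [mul_assoc]
        exact hr' _ (by rw [X.Delta_mul, ht, AddMonoidHom.comp_zero]))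

theorem mem_annihilatorIdeal {r : R} : r ∈ X.annihilatorIdeal ↔
    X.Delta r ∈ X.finiteRank ∧ ∀ s, X.Delta s = 0 → r * s = 0 :=
  TwoSidedIdeal.mem_mk' _ _ _ _ _ _ _

/-- The kernel of `Δ`. -/
def kerDelta : TwoSidedIdeal R :=
  TwoSidedIdeal.mk' {r | X.Delta r = 0} X.Delta_zero
    (fun {r s} (hr : X.Delta r = 0) (hs : X.Delta s = 0) => by
      change X.Delta (r + s) = 0
      rw [X.Delta_add, hr, hs, add_zero])
    (fun {r} (hr : X.Delta r = 0) => by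
      change X.Delta (-r) = 0
      rw [X.Delta_neg, hr, neg_zero])
    (fun {s r} (hr : X.Delta r = 0) => by
      change X.Delta (s * r) = 0
      rw [X.Delta_mul, hr, AddMonoidHom.comp_zero])
    (fun {r s} (hr : X.Delta r = 0) => by
      change X.Delta (r * s) = 0
      rw [X.Delta_mul, hr, AddMonoidHom.zero_comp])

theorem mem_kerDelta {r : R} : r ∈ X.kerDelta ↔ X.Delta r = 0 :=
  TwoSidedIdeal.mem_mk' _ _ _ _ _ _ _

/-- Elements of the ideal annihilate ker Δ, so its intersection with ker Δ has square zero and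
vanishes by semiprimeness. Conversely, for r in a faithful ideal J' and s in ker Δ, rs lies in J' ∩
ker Δ = 0. -/
theorem isUniquelyMaximal_annihilatorIdeal (hR : IsSemiprimeRing R) :
    X.IsUniquelyMaximal X.annihilatorIdeal where
  compatible r hr := (X.mem_annihilatorIdeal.1 hr).1
  faithful r hr h0 := by
    refine hR (X.annihilatorIdeal ⊓ X.kerDelta) (fun a ha b hb => ?_) r
      ((TwoSidedIdeal.mem_inf R).2 ⟨hr, X.mem_kerDelta.2 h0⟩)
    exact (X.mem_annihilatorIdeal.1 ((TwoSidedIdeal.mem_inf R).1 ha).1).2 b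
      (X.mem_kerDelta.1 ((TwoSidedIdeal.mem_inf R).1 hb).2)
  le_of_faithful J' hc hf r hr := by
    refine X.mem_annihilatorIdeal.2 ⟨hc r hr, fun s hs => ?_⟩
    exact hf _ (J'.mul_mem_right r s hr) (by rw [X.Delta_mul, hs, AddMonoidHom.comp_zero])

end RSystem

/-- Lift b to a family of homogeneous terms. Their images sum to zero in a direct sum, so each image
vanishes, hence each term. The subgroups of the source need only span. -/
theorem eq_zero_of_graded_of_mem_iSup {ι : Type*} [DecidableEq ι] {B : Type x} {A : Type y}
    [AddCommGroup B] [AddCommGroup A] (ℬ : ι → AddSubgroup B) (𝒜 : ι → AddSubgroup A)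
    (h𝒜 : DirectSum.IsInternal 𝒜) (η : B →+ A) (hη : ∀ k, ∀ b ∈ ℬ k, η b ∈ 𝒜 k)
    (h : ∀ k, ∀ b ∈ ℬ k, η b = 0 → b = 0) {b : B} (hb : b ∈ ⨆ k, ℬ k) (h0 : η b = 0) : b = 0 := by
  have hle : ⨆ k, ℬ k ≤ (DirectSum.coeAddMonoidHom ℬ).range := iSup_le fun k b hb =>
    ⟨DirectSum.of _ k ⟨b, hb⟩, DirectSum.coeAddMonoidHom_of ..⟩
  obtain ⟨f, rfl⟩ := hle hb
  let g : ∀ k, ℬ k →+ 𝒜 k := fun k => (η.comp (ℬ k).subtype).codRestrict (𝒜 k) fun b => hη k b b.2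
  have hcomp : (DirectSum.coeAddMonoidHom 𝒜).comp (DirectSum.map g)
      = η.comp (DirectSum.coeAddMonoidHom ℬ) := by
    ext k b
    simp [g]
    rfl
  have h1 : DirectSum.map g f = 0 := by
    refine h𝒜.1 ?_
    rw [map_zero]
    exact (DFunLike.congr_fun hcomp f).trans h0
  have h2 : f = 0 := by
    refine DFinsupp.ext fun k => Subtype.ext (h k _ (f k).2 ?_)
    exact congrArg Subtype.val (DFunLike.congr_fun h1 k)
  rw [h2, map_zero]

end CuntzPimsner

theorem corollary5 {R : Type*} {P : Type*} {Q : Type*} [NonUnitalRing R]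
    [AddCommGroup P] [AddCommGroup Q]
    [SMul R P] [SMul Rᵐᵒᵖ P] [CuntzPimsner.NUBimodule R P]
    [SMul R Q] [SMul Rᵐᵒᵖ Q] [CuntzPimsner.NUBimodule R Q]
    (X : CuntzPimsner.RSystem R P Q) (hFS : X.FS) :
    (∀ J : TwoSidedIdeal R, X.IsUniquelyMaximal J →
      ∀ (A : Type*) [NonUnitalRing A] (𝒜 : ℤ → AddSubgroup A), CuntzPimsner.IsZGrading 𝒜 →
      ∀ η : X.RelCuntzPimsner J →ₙ+* A,
        (∀ k : ℤ, ∀ b ∈ (X.cuntzPimsnerRep J).component k, η b ∈ 𝒜 k) →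
        (∀ r : R, r ≠ 0 → η ((X.cuntzPimsnerRep J).σ r) ≠ 0) →
        Function.Injective η) ∧
    (CuntzPimsner.IsSemiprimeRing R → ∃ J : TwoSidedIdeal R, X.IsUniquelyMaximal J) := by
  refine ⟨fun J hJ A _ 𝒜 h𝒜 η hgr hσ => ?_, fun hR => ⟨_, X.isUniquelyMaximal_annihilatorIdeal hR⟩⟩
  refine (injective_iff_map_eq_zero η).2 fun b hb => ?_
  refine CuntzPimsner.eq_zero_of_graded_of_mem_iSup _ 𝒜 h𝒜.isInternal η.toAddMonoidHom hgr ?_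
    (X.mem_iSup_component_cuntzPimsnerRep J b) hb
  intro k b hb h0
  exact CuntzPimsner.CovariantRep.eq_zero_of_mem_component hFS hJ
    (fun r hr b => X.cuntzPimsnerRep_σ_eq hFS hJ.compatible hr)
    (fun r hr => by_contra fun hne => hσ r hne hr) k hb h0
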